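/- Let $F:\mathbb R^p\to\mathbb R^p$ be single-valued, let $T:\mathbb R^p\rightrightarrows\mathbb R^p$ be set-valued, and put $\Phi:=F+T$. Suppose that $\{x: 0\in\Phi x\}\neq\emptyset$, that $\Phi$ is $\rho$-co-hypomonotone for some $\rho\ge 0$ (that is, $\langle u-v,x-y\rangle\ge-\rho\|u-v\|^2$ whenever $u\in\Phi x$, $v\in\Phi y$), and that $F$ is $L$-Lipschitz continuous with $L>0$. Fix $r>2$, $\mu>1$, $\epsilon\ge 0$, $\hat\epsilon\ge 0$, $\kappa\ge 0$ and $0\le\hat\kappa<\frac{3r-1}{3r(12+3r+\hat\epsilon)}$, and set $$\Psi:=\frac{1}{\sqrt{4+12\kappa+3\kappa r+\kappa\hat\epsilon}}\Big[1-\frac1{3r}-\hat\kappa(12+3r+\hat\epsilon)\Big],\qquad \bar\eta:=\frac{\Psi}{L},\qquad \beta:=8\rho+2\epsilon .$$ Suppose that $L\rho<\frac{(r-2)\Psi}{8(r+\mu-1)}$, and choose $\eta$ with $\eta>\beta$ and $\frac{(r+\mu-1)\beta}{r-2}\le\eta<\bar\eta$. Let $$\delta:=(r-1)\beta+\frac{(r-2)(\eta-\beta)}{\mu+1},\qquad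 \omega:=\frac{\mu(\eta-\beta)}{\mu+1},$$ $$t_0:=\max\Big\{\bar t_0,\ \hat t_0,\ r,\ \frac{\eta(r-1)}{\eta-\beta},\ \frac{\mu}{\omega}(r-1)[\eta-(2r+1)\omega],\ \frac{(r-2)\sqrt{\omega r}}{\sqrt{\eta(\mu-1)}}\Big\},$$ where $\bar t_0:=\frac{D+\sqrt{D^2+4\eta E}}{2\eta}$ with $D:=2\delta+\omega(r+\mu-1)^2+6r\eta+2\beta+2\hat\epsilon\eta$ and $E:=4\rho r(r-2)+3r\eta+8\rho+\hat\epsilon\eta$, and where $\hat t_0:=\frac{B+\sqrt{B^2-AC}}{A}$ if $B^2\ge AC$ and $\hat t_0:=0$ otherwise, with $$A:=\frac{(\eta-\beta)^2}{(\mu+1)^2}\Big(\mu-\frac1{2r}-\frac12\Big),$$ $$B:=\frac{\eta-\beta}{(\mu+1)^2}\Big[\frac{(r-1)[2r\mu(\eta-\beta)-(\eta+\mu\beta)]}{2r}+\rho(\mu+1)(2r\mu-1)\Big],$$ $$C:=(r-1)\Big\{\frac{(r-1)(\eta+\mu\beta)}{(\mu+1)^2}\Big[\Big(\mu-\frac1{2r}\Big)\eta-\frac{(2r+1)\mu\beta}{2r}\Big]-2\rho[\eta-(2r+1)\omega]\Big\}.$$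 For $k\ge0$ let $t_k:=k+t_0$ and $$\theta_k:=\frac{t_k-r-\mu}{t_{k+1}},\quad \gamma_k:=\frac{t_k-r+1}{t_k},\quad \eta_k:=\frac{(\eta-\beta)t_k-\delta}{t_{k+1}},\quad \lambda_k:=\frac{\eta t_k}{t_{k+1}},\quad \nu_k:=\frac{\beta t_k}{t_{k+1}}.$$ Let $(x^k)$, $(y^k)$, $(u^k)$, $(\xi^k)$, $k\ge0$, be sequences in $\mathbb R^p$ with $\xi^k\in Tx^k$ for all $k$, $u^0=Fx^0$, $y^0=x^0$, and, for all $k\ge0$, with $z^k:=u^k+\xi^k$ and $\hat w^{k+1}:=Fy^k+\xi^{k+1}$, $$x^{k+1}=y^k-\eta d^k,\qquad d^k:=\hat w^{k+1}-\gamma_kz^k,$$ $$y^{k+1}=x^{k+1}+\theta_k(x^{k+1}-x^k)-p^k,\qquad p^k:=\eta_kz^{k+1}-\lambda_k\hat w^{k+1}+\nu_kz^k,$$ $$\|Fx^{k+1}-u^{k+1}\|^2\le\kappa\|Fx^{k+1}-Fy^k\|^2+\hat\kappa\|d^k\|^2.$$ Then $$\lim_{k\to\infty}k^2\|Fx^k+\xi^k\|^2=0,\qquad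 \lim_{k\to\infty}k^2\|x^{k+1}-x^k\|^2=0,\qquad \lim_{k\to\infty}k^2\|y^k-x^k\|^2=0;$$ that is, $\|Fx^k+\xi^k\|$, $\|x^{k+1}-x^k\|$ and $\|y^k-x^k\|$ are all $o(1/k)$ as $k\to\infty$. -/

import Mathlib

open scoped Asymptotics

noncomputable section

namespace GAEG

/-! ### Operators -/

section Operators

variable {E : Type*} [NormedAddCommGroup E] [InnerProductSpace ℝ E]

/-- The set-valued sum `F + T` of a single-valued operator `F` and a set-valued operator `T`. -/
def sumOp (F : E → E) (T : E → Set E) : E → Set E :=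
  fun x => {w | ∃ ξ ∈ T x, w = F x + ξ}

/-- The zeros of a set-valued operator. -/
def zer (S : E → Set E) : Set E := {x | 0 ∈ S x}

/-- `S` is `ρ`-co-hypomonotone: `⟪u - v, x - y⟫ ≥ -ρ ‖u - v‖²` on its graph. -/
def IsCoHypomonotone (ρ : ℝ) (S : E → Set E) : Prop :=
  ∀ x y : E, ∀ u ∈ S x, ∀ v ∈ S y, -ρ * ‖u - v‖ ^ 2 ≤ inner ℝ (u - v) (x - y)

end Operators

/-! ### Parameters -/

/-- The free real constants of the method. -/
structure Params where
  r : ℝ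
  μ : ℝ
  ρ : ℝ
  L : ℝ
  κ : ℝ
  κhat : ℝ
  ε : ℝ
  εhat : ℝ
  η : ℝ

namespace Params

variable (P : Params)

def β : ℝ := 8 * P.ρ + 2 * P.ε

def δ : ℝ := (P.r - 1) * P.β + (P.r - 2) * (P.η - P.β) / (P.μ + 1)

def ω : ℝ := P.μ * (P.η - P.β) / (P.μ + 1)

/-- The strict upper bound imposed on `κhat`. -/
def κhatBound : ℝ := (3 * P.r - 1) / (3 * P.r * (12 + 3 * P.r + P.εhat))

def Ψ : ℝ :=
  1 / √(4 + 12 * P.κ + 3 * P.κ * P.r + P.κ * P.εhat) *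
    (1 - 1 / (3 * P.r) - P.κhat * (12 + 3 * P.r + P.εhat))

/-- The upper bound `Ψ / L` of the stepsize. -/
def ηbar : ℝ := P.Ψ / P.L

def D : ℝ :=
  2 * P.δ + P.ω * (P.r + P.μ - 1) ^ 2 + 6 * P.r * P.η + 2 * P.β + 2 * P.εhat * P.η

def E : ℝ := 4 * P.ρ * P.r * (P.r - 2) + 3 * P.r * P.η + 8 * P.ρ + P.εhat * P.η

/-- The first lower threshold `t̄₀` for the initial value of `t`. -/
def tbar : ℝ := (P.D + √(P.D ^ 2 + 4 * P.η * P.E)) / (2 * P.η)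

def A : ℝ :=
  (P.η - P.β) ^ 2 / (P.μ + 1) ^ 2 * (P.μ - 1 / (2 * P.r) - 1 / 2)

def B : ℝ :=
  (P.η - P.β) / (P.μ + 1) ^ 2 *
    ((P.r - 1) * (2 * P.r * P.μ * (P.η - P.β) - (P.η + P.μ * P.β)) / (2 * P.r)
      + P.ρ * (P.μ + 1) * (2 * P.r * P.μ - 1))

def C : ℝ :=
  (P.r - 1) *
    ((P.r - 1) * (P.η + P.μ * P.β) / (P.μ + 1) ^ 2 *
        ((P.μ - 1 / (2 * P.r)) * P.η - (2 * P.r + 1) * P.μ * P.β / (2 * P.r))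
      - 2 * P.ρ * (P.η - (2 * P.r + 1) * P.ω))

open Classical in
/-- The second lower threshold `t̂₀` for the initial value of `t`. -/
def that : ℝ :=
  if P.A * P.C ≤ P.B ^ 2 then (P.B + √(P.B ^ 2 - P.A * P.C)) / P.A else 0

/-- The initial value of `t`, a maximum of six quantities. -/
def t₀ : ℝ :=
  max P.tbar (max P.that (max P.r (max (P.η * (P.r - 1) / (P.η - P.β))
    (max (P.μ / P.ω * (P.r - 1) * (P.η - (2 * P.r + 1) * P.ω))
      ((P.r - 2) * √(P.ω * P.r) / √(P.η * (P.μ - 1)))))))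

def t (k : ℕ) : ℝ := k + P.t₀

def θ (k : ℕ) : ℝ := (P.t k - P.r - P.μ) / P.t (k + 1)

def γ (k : ℕ) : ℝ := (P.t k - P.r + 1) / P.t k

/-- The coefficient `η_k` (as opposed to the stepsize `η`). -/
def ηseq (k : ℕ) : ℝ := ((P.η - P.β) * P.t k - P.δ) / P.t (k + 1)

def lam (k : ℕ) : ℝ := P.η * P.t k / P.t (k + 1)

def ν (k : ℕ) : ℝ := P.β * P.t k / P.t (k + 1)

end Params

/-! ### The scheme -/

section Scheme

variable {E : Type*} [NormedAddCommGroup E] [InnerProductSpace ℝ E]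

/-- `z^k = u^k + ξ^k`. -/
def zSeq (u ξ : ℕ → E) (k : ℕ) : E := u k + ξ k

/-- `ŵ^{k+1} = F y^k + ξ^{k+1}`, indexed by `k`. -/
def whatSucc (F : E → E) (y ξ : ℕ → E) (k : ℕ) : E := F (y k) + ξ (k + 1)

/-- `d^k = ŵ^{k+1} - γ_k z^k`. -/
def dSeq (P : Params) (F : E → E) (y u ξ : ℕ → E) (k : ℕ) : E :=
  whatSucc F y ξ k - P.γ k • zSeq u ξ k

/-- `p^k = η_k z^{k+1} - λ_k ŵ^{k+1} + ν_k z^k`. -/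
def pSeq (P : Params) (F : E → E) (y u ξ : ℕ → E) (k : ℕ) : E :=
  P.ηseq k • zSeq u ξ (k + 1) - P.lam k • whatSucc F y ξ k + P.ν k • zSeq u ξ k

/-- The sequences `x, y, u, ξ` are generated by the generalized accelerated extragradient scheme
for `0 ∈ F x + T x`. The `x`-update is implicit, because `d^k` involves `ξ^{k+1} ∈ T x^{k+1}`. -/
structure IsGenerated (P : Params) (F : E → E) (T : E → Set E) (x y u ξ : ℕ → E) : Prop where
  /-- In particular `x^0` lies in the domain of `F + T`. -/
  ξ_mem : ∀ k, ξ k ∈ T (x k)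
  u_zero : u 0 = F (x 0)
  y_zero : y 0 = x 0
  x_succ : ∀ k, x (k + 1) = y k - P.η • dSeq P F y u ξ k
  y_succ : ∀ k, y (k + 1) = x (k + 1) + P.θ k • (x (k + 1) - x k) - pSeq P F y u ξ k
  /-- The condition on the direction `u^{k+1}`; the one on `u^0` (with `y^{-1} = x^0` and
  `d^{-1} = 0`) says exactly `u^0 = F x^0`. -/
  u_cond : ∀ k, ‖F (x (k + 1)) - u (k + 1)‖ ^ 2 ≤
    P.κ * ‖F (x (k + 1)) - F (y k)‖ ^ 2 + P.κhat * ‖dSeq P F y u ξ k‖ ^ 2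

end Scheme

end GAEG

end

/-! Measured from a zero of `F + T`, the iterates satisfy a linear recursion (`ErrorDynamics`) whose
errors obey `4‖f‖² + 12‖e⁺‖² ≤ ‖d‖²` by the stepsize bound. Two functions of this recursion matter.
The `energy` involves only `U`, `t w` and `t e`; `lyapunov` adds terms in the distance `p` to the
zero.

Along the dynamics `lyapunov` decreases by a multiple of `G`, up to a relative error `O(t⁻²)`, so
`G` is summable (`summable_G`). The leading terms are handled by `leading_form_le` and
co-hypomonotonicity; all other terms pair a vector of order `√(G/t)` with one of order `√G`, hence
are `o(G)`.

The energy grows by at most a multiple of `G`, so it converges. It is also `O(t G)`, so a positive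
limit would give `1/k = O(G)`, against summability (`tendsto_zero_of_isBigO_mul`). Thus `t w` and
`U` tend to zero; `G → 0` gives the same for `t d` and `t e`, and solving for `t X` yields the
remaining rates. -/

noncomputable section

namespace GAEG

open Filter Topology

/-! ### Algebra of one energy step -/

section Algebra

variable {H : Type*} [NormedAddCommGroup H] [InnerProductSpace ℝ H]

/-- Exact one-step change of the energy
`½‖U‖² + ½ σ ω t² ‖w‖² + 2 ω η t² ‖e‖²`, split into its leading part and a remainder made of
inner products of asymptotically smaller vectors. -/
theorem energy_step_identity (r μ ρ η b σ ω t : ℝ) (X w e d f g e' : H) :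
    let a := ω + σ
    let h₀ := d + f + e
    let h := h₀ + g
    let R := -((r - 1) * ω) • w - ((r - 2) * ω) • e - (μ + r) • X
    let U := t • X + (η * t) • d + (a * t - b) • (w + e) - (ω * t) • w
    let U' := U + R - (ω * (t + 1)) • h
    (1 / 2 * ‖U'‖ ^ 2 + σ * ω / 2 * (t + 1) ^ 2 * ‖w + h‖ ^ 2
        + 2 * ω * η * (t + 1) ^ 2 * ‖e'‖ ^ 2)
      - (1 / 2 * ‖U‖ ^ 2 + σ * ω / 2 * t ^ 2 * ‖w‖ ^ 2 + 2 * ω * η * t ^ 2 * ‖e‖ ^ 2)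
    = -(μ + r) * t * ‖X‖ ^ 2 - ((r - 1) * ω + (μ + r) * σ) * t * inner ℝ w X
      - (r - 2) * ω * σ * t * ‖w‖ ^ 2
      - ω * (t + 1) * t * (inner ℝ h X + ρ * ‖h‖ ^ 2)
      + (t + 1) ^ 2 * ω * (ρ * ‖h₀‖ ^ 2 - η * inner ℝ h₀ d - a * inner ℝ h₀ e
          + a / 2 * ‖h₀‖ ^ 2 + 2 * η * (‖e'‖ ^ 2 - ‖e‖ ^ 2))
      + (inner ℝ R (η • t • d + a • t • e - b • (w + e))
        - (r - 2) * ω * inner ℝ (X + σ • w) (t • e)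
        + ω * inner ℝ (b • (w + e) - R + σ • w + η • d + a • e - ρ • h) ((t + 1) • h)
        + 1 / 2 * inner ℝ R R + σ * ω / 2 * inner ℝ w w
        + 2 * ω * η * inner ℝ e ((2 : ℝ) • t • e + e)
        + ω * inner ℝ ((t + 1) • g) ((2 * ρ + a) • (t + 1) • h₀ + (ρ + a / 2) • (t + 1) • g
            - (t + 1) • (η • d + a • e))) := by
  intro a h₀ h R U U'
  simp only [a, h₀, h, R, U, U', ← real_inner_self_eq_norm_sq, inner_add_left, inner_add_right,
    inner_sub_left, inner_sub_right, real_inner_smul_left, real_inner_smul_right, smul_add,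
    neg_smul, inner_neg_left, inner_neg_right]
  simp only [real_inner_comm]
  ring

/-- The leading quadratic form of the energy decrease is negative definite. -/
theorem leading_form_le (ρ η a : ℝ) (hρ : 0 ≤ ρ) (ha : 0 ≤ a) (haη : a ≤ η - 8 * ρ)
    (d f e e' : H) (hf : 4 * ‖f‖ ^ 2 + 12 * ‖e'‖ ^ 2 ≤ ‖d‖ ^ 2) :
    ρ * ‖d + f + e‖ ^ 2 - η * inner ℝ (d + f + e) d - a * inner ℝ (d + f + e) e
        + a / 2 * ‖d + f + e‖ ^ 2 + 2 * η * (‖e'‖ ^ 2 - ‖e‖ ^ 2)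
      ≤ -(η / 12) * (‖d‖ ^ 2 + ‖e‖ ^ 2) := by
  -- The `a`-terms equal `a/2 (‖d+f‖² - ‖e‖²)`. Polarising `⟪d+f, d⟫` yields `-η/2 ‖d+f‖²`, which
  -- with `a ≤ η - 8ρ` absorbs the `ρ`-term. The square `h1` handles `⟪e, d⟫`, leaving `-1/2 + 1/6 +
  -- 1/4 = -1/12` in front of `η‖d‖²`.
  have h1 : 0 ≤ ‖(1 / 2 : ℝ) • d + e‖ ^ 2 := by positivity
  have h2 : 0 ≤ ‖d + f - e‖ ^ 2 := by positivity
  have h3 : 0 ≤ ‖d + f‖ ^ 2 := by positivity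
  have h4 : 0 ≤ ‖e‖ ^ 2 := by positivity
  have h5 : 0 ≤ ‖f‖ ^ 2 := by positivity
  have hη : 0 ≤ η := by linarith
  have k1 := mul_le_mul_of_nonneg_left hf hη
  have k2 := mul_nonneg hη h1
  have k3 := mul_nonneg hρ h2
  have k4 := mul_nonneg (sub_nonneg.2 haη) h3
  have k5 := mul_nonneg ha h4
  have k6 := mul_nonneg hρ h3
  have k7 := mul_nonneg hη h5
  have k8 := mul_nonneg (sub_nonneg.2 haη) h4
  have k9 := mul_nonneg hη h4
  have k10 := mul_nonneg hρ h4
  simp only [← real_inner_self_eq_norm_sq, inner_add_left, inner_add_right,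
    inner_sub_left, inner_sub_right, real_inner_smul_left, real_inner_smul_right] at *
  simp only [real_inner_comm] at *
  nlinarith

end Algebra

/-! ### Abstract dynamics and energies -/

/-- The error dynamics of an accelerated scheme with vanishing damping: `X` is the displacement of
the iterates, `p` their distance vector to a solution, `w` the residual, `e` its inexactness,
`d` the search direction and `f` the extrapolation error of the operator. -/
structure ErrorDynamics (H : Type*) [NormedAddCommGroup H] [InnerProductSpace ℝ H] where
  (r μ ρ η a b : ℝ)
  t : ℕ → ℝ
  (X w e d f p : ℕ → H)
  two_lt_r : 2 < r
  one_lt_μ : 1 < μ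
  ρ_nonneg : 0 ≤ ρ
  a_pos : 0 < a
  a_le : a ≤ η - 8 * ρ
  one_le_t : ∀ k, 1 ≤ t k
  t_succ : ∀ k, t (k + 1) = t k + 1
  p_succ : ∀ k, p (k + 1) = p k + X k
  w_succ : ∀ k, w (k + 1) = w k + (d k + f k + e k + (-((r - 1) / t k)) • (w k + e k))
  momentum_succ : ∀ k,
    t (k + 1) • X (k + 1) + (η * t (k + 1)) • d (k + 1)
        + (a * t (k + 1) - b) • (w (k + 1) + e (k + 1))
      = t k • X k + (η * t k) • d k + (a * t k - b) • (w k + e k)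
        - ((r - 2) * (μ * a / (μ + 1))) • (w k + e k) - (r + μ) • X k
  hypomonotone : ∀ k, -ρ * ‖w (k + 1) - w k‖ ^ 2 ≤ inner ℝ (w (k + 1) - w k) (X k)
  hypomonotone_sol : ∀ k, -ρ * ‖w k‖ ^ 2 ≤ inner ℝ (w k) (p k)
  error_le : ∀ k, 4 * ‖f k‖ ^ 2 + 12 * ‖e (k + 1)‖ ^ 2 ≤ ‖d k‖ ^ 2

namespace ErrorDynamics

variable {H : Type*} [NormedAddCommGroup H] [InnerProductSpace ℝ H] (D : ErrorDynamics H)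

def ω : ℝ := D.μ * D.a / (D.μ + 1)

def σ : ℝ := D.a / (D.μ + 1)

/-- The quantity dissipated by the dynamics. -/
def G (k : ℕ) : ℝ :=
  D.t k * ‖D.X k‖ ^ 2 + D.t k * ‖D.w k‖ ^ 2 + D.t k ^ 2 * ‖D.d k‖ ^ 2 + D.t k ^ 2 * ‖D.e k‖ ^ 2

/-- The momentum variable, without the contribution of the distance to the solution. -/
def N (k : ℕ) : H :=
  D.t k • D.X k + (D.η * D.t k) • D.d k + (D.a * D.t k - D.b) • (D.w k + D.e k)

def U (k : ℕ) : H := D.N k - (D.ω * D.t k) • D.w k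

/-- The energy that does not involve the distance to the solution. -/
def energy (k : ℕ) : ℝ :=
  1 / 2 * ‖D.U k‖ ^ 2 + D.σ * D.ω / 2 * D.t k ^ 2 * ‖D.w k‖ ^ 2
    + 2 * D.ω * D.η * D.t k ^ 2 * ‖D.e k‖ ^ 2

def lyapunov (k : ℕ) : ℝ :=
  D.energy k + D.r * inner ℝ (D.p k) (D.N k) + D.r * (D.r + D.μ) / 2 * ‖D.p k‖ ^ 2

lemma t_pos (k : ℕ) : 0 < D.t k := one_pos.trans_le (D.one_le_t k)

lemma ω_add_σ : D.ω + D.σ = D.a := by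
  have := D.one_lt_μ
  unfold ω σ; field_simp

lemma μ_mul_σ : D.μ * D.σ = D.ω := by
  unfold ω σ; ring

lemma σ_pos : 0 < D.σ := div_pos D.a_pos (by linarith [D.one_lt_μ])

lemma ω_pos : 0 < D.ω := by
  rw [← D.μ_mul_σ]; exact mul_pos (by linarith [D.one_lt_μ]) D.σ_pos

lemma η_pos : 0 < D.η := by linarith [D.a_pos, D.a_le, D.ρ_nonneg]

lemma t_eq (k : ℕ) : D.t k = D.t 0 + k := by
  induction k with
  | zero => simp
  | succ k ih => rw [D.t_succ, ih]; push_cast; ring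

lemma tendsto_t : Tendsto D.t atTop atTop := by
  have : D.t = fun k : ℕ => D.t 0 + (k : ℝ) := funext D.t_eq
  rw [this]
  exact tendsto_atTop_add_const_left _ _ tendsto_natCast_atTop_atTop

lemma G_nonneg (k : ℕ) : 0 ≤ D.G k := by
  have := D.t_pos k
  unfold G; positivity

lemma energy_nonneg (k : ℕ) : 0 ≤ D.energy k := by
  have := D.σ_pos; have := D.ω_pos; have := D.η_pos
  unfold energy; positivity

/-! ### Orders of magnitude relative to the dissipation -/

section Orders

/-- `v` has the order of a vector `v` with `t ‖v‖²` dissipated. -/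
def Small (v : ℕ → H) : Prop := v =O[atTop] fun k => √(D.G k / D.t k)

/-- `v` has the order of a vector with `‖v‖²` dissipated. -/
def Dissipated (v : ℕ → H) : Prop := v =O[atTop] fun k => √(D.G k)

variable {D} {v v' : ℕ → H}

lemma Small.add (h : D.Small v) (h' : D.Small v') : D.Small fun k => v k + v' k :=
  Asymptotics.IsBigO.add h h'

lemma Small.sub (h : D.Small v) (h' : D.Small v') : D.Small fun k => v k - v' k :=
  Asymptotics.IsBigO.sub h h'

lemma Small.smul (h : D.Small v) (c : ℝ) : D.Small fun k => c • v k :=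
  Asymptotics.IsBigO.const_smul_left h c

lemma Dissipated.add (h : D.Dissipated v) (h' : D.Dissipated v') :
    D.Dissipated fun k => v k + v' k :=
  Asymptotics.IsBigO.add h h'

lemma Dissipated.sub (h : D.Dissipated v) (h' : D.Dissipated v') :
    D.Dissipated fun k => v k - v' k :=
  Asymptotics.IsBigO.sub h h'

lemma Dissipated.smul (h : D.Dissipated v) (c : ℝ) : D.Dissipated fun k => c • v k :=
  Asymptotics.IsBigO.const_smul_left h c

lemma Small.dissipated (h : D.Small v) : D.Dissipated v := by
  refine Asymptotics.IsBigO.trans h (Asymptotics.isBigO_of_le _ fun k => ?_)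
  rw [Real.norm_of_nonneg (Real.sqrt_nonneg _), Real.norm_of_nonneg (Real.sqrt_nonneg _)]
  exact Real.sqrt_le_sqrt (div_le_self (D.G_nonneg k) (D.one_le_t k))

/-- Dividing by `t` turns a dissipated vector into a small one. -/
lemma Dissipated.small_of_smul (h : D.Dissipated fun k => D.t k • v k) : D.Small v := by
  obtain ⟨c, hc⟩ := Asymptotics.IsBigO.bound h
  refine Asymptotics.IsBigO.of_bound c ?_
  filter_upwards [hc] with k hk
  have ht := D.t_pos k
  rw [norm_smul, Real.norm_of_nonneg ht.le, Real.norm_of_nonneg (Real.sqrt_nonneg _)] at hk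
  rw [Real.norm_of_nonneg (Real.sqrt_nonneg _), Real.sqrt_div (D.G_nonneg k)]
  have hs : √(D.t k) ≤ D.t k := Real.sqrt_le_self_iff.2 (Or.inr (D.one_le_t k))
  have hs0 : 0 < √(D.t k) := Real.sqrt_pos.2 ht
  rw [← mul_div_assoc, le_div_iff₀ hs0]
  nlinarith [mul_le_mul_of_nonneg_right hs (norm_nonneg (v k))]

/-- By Cauchy–Schwarz the product is of order `√(G/t) √G = G/√t`, and `t → ∞`. -/
lemma Small.inner_isLittleO (h : D.Small v) (h' : D.Dissipated v') :
    (fun k => inner ℝ (v k) (v' k)) =o[atTop] D.G := by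
  have h1 : (fun k => inner ℝ (v k) (v' k)) =O[atTop]
      fun k => √(D.G k / D.t k) * √(D.G k) :=
    (Asymptotics.isBigO_of_le _ fun k => by
      simpa using norm_inner_le_norm (𝕜 := ℝ) (v k) (v' k)).trans
      (Asymptotics.IsBigO.mul h.norm_left h'.norm_left)
  refine h1.trans_isLittleO ?_
  have h2 : (fun k => √(D.G k / D.t k) * √(D.G k)) = fun k => (√(D.t k))⁻¹ * D.G k := by
    funext k
    rw [Real.sqrt_div (D.G_nonneg k), div_mul_eq_mul_div, Real.mul_self_sqrt (D.G_nonneg k)]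
    ring
  rw [h2]
  have h3 : (fun k => (√(D.t k))⁻¹) =o[atTop] fun _ => (1 : ℝ) :=
    (Asymptotics.isLittleO_one_iff ℝ).2
      (tendsto_inv_atTop_zero.comp (Real.tendsto_sqrt_atTop.comp D.tendsto_t))
  simpa using h3.mul_isBigO (Asymptotics.isBigO_refl D.G atTop)

variable (D)

lemma dissipated_of_sq_le (c : ℝ) (hc : 0 ≤ c) (h : ∀ k, ‖v k‖ ^ 2 ≤ c ^ 2 * D.G k) :
    D.Dissipated v := by
  refine Asymptotics.IsBigO.of_bound c (Eventually.of_forall fun k => ?_)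
  rw [Real.norm_of_nonneg (Real.sqrt_nonneg _)]
  refine abs_le_of_sq_le_sq' ?_ (by positivity) |>.2
  rw [mul_pow, Real.sq_sqrt (D.G_nonneg k)]
  exact h k

lemma small_of_le (h : ∀ k, D.t k * ‖v k‖ ^ 2 ≤ D.G k) : D.Small v := by
  refine Asymptotics.isBigO_of_le _ fun k => ?_
  rw [Real.norm_of_nonneg (Real.sqrt_nonneg _)]
  refine Real.le_sqrt_of_sq_le ?_
  rw [le_div_iff₀ (D.t_pos k), mul_comm]
  exact h k

lemma small_X : D.Small D.X := D.small_of_le fun k => by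
  have := D.t_pos k
  have : 0 ≤ D.t k * ‖D.w k‖ ^ 2 + D.t k ^ 2 * ‖D.d k‖ ^ 2 + D.t k ^ 2 * ‖D.e k‖ ^ 2 := by
    positivity
  unfold G; linarith

lemma small_w : D.Small D.w := D.small_of_le fun k => by
  have := D.t_pos k
  have : 0 ≤ D.t k * ‖D.X k‖ ^ 2 + D.t k ^ 2 * ‖D.d k‖ ^ 2 + D.t k ^ 2 * ‖D.e k‖ ^ 2 := by
    positivity
  unfold G; linarith

lemma dissipated_d : D.Dissipated fun k => D.t k • D.d k :=
  D.dissipated_of_sq_le 1 zero_le_one fun k => by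
    have := D.t_pos k
    have : 0 ≤ D.t k * ‖D.X k‖ ^ 2 + D.t k * ‖D.w k‖ ^ 2 + D.t k ^ 2 * ‖D.e k‖ ^ 2 := by
      positivity
    rw [norm_smul, mul_pow, Real.norm_eq_abs, sq_abs]
    unfold G; linarith

lemma dissipated_e : D.Dissipated fun k => D.t k • D.e k :=
  D.dissipated_of_sq_le 1 zero_le_one fun k => by
    have := D.t_pos k
    have : 0 ≤ D.t k * ‖D.X k‖ ^ 2 + D.t k * ‖D.w k‖ ^ 2 + D.t k ^ 2 * ‖D.d k‖ ^ 2 := by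
      positivity
    rw [norm_smul, mul_pow, Real.norm_eq_abs, sq_abs]
    unfold G; linarith

lemma dissipated_f : D.Dissipated fun k => D.t k • D.f k :=
  D.dissipated_of_sq_le 1 zero_le_one fun k => by
    have := D.t_pos k
    have : 0 ≤ D.t k * ‖D.X k‖ ^ 2 + D.t k * ‖D.w k‖ ^ 2 + D.t k ^ 2 * ‖D.e k‖ ^ 2 := by
      positivity
    have h2 : D.t k ^ 2 * ‖D.f k‖ ^ 2 ≤ D.t k ^ 2 * ‖D.d k‖ ^ 2 := by
      gcongr ?_ * ?_
      nlinarith [D.error_le k, sq_nonneg ‖D.f k‖, sq_nonneg ‖D.e (k + 1)‖]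
    rw [norm_smul, mul_pow, Real.norm_eq_abs, sq_abs]
    unfold G; linarith

end Orders

section Orders

variable {D} {v : ℕ → H}

lemma Dissipated.t_add_one_smul (h : D.Dissipated fun k => D.t k • v k) :
    D.Dissipated fun k => (D.t k + 1) • v k := by
  have := h.add h.small_of_smul.dissipated
  simpa [add_smul] using this

lemma Small.inv_smul (h : D.Small v) : D.Small fun k => (D.t k)⁻¹ • v k := by
  refine (Asymptotics.isBigO_of_le _ fun k => ?_).trans h
  rw [norm_smul, Real.norm_of_nonneg (inv_nonneg.2 (D.t_pos k).le)]
  exact mul_le_of_le_one_left (norm_nonneg _) (inv_le_one_of_one_le₀ (D.one_le_t k))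

end Orders

/-! ### One-step estimates -/

lemma small_e : D.Small D.e := D.dissipated_e.small_of_smul

lemma small_d : D.Small D.d := D.dissipated_d.small_of_smul

lemma U_succ (k : ℕ) :
    D.U (k + 1) = D.U k
      + (-((D.r - 1) * D.ω) • D.w k - ((D.r - 2) * D.ω) • D.e k - (D.μ + D.r) • D.X k)
      - (D.ω * (D.t k + 1)) • (D.d k + D.f k + D.e k
        + (-((D.r - 1) / D.t k)) • (D.w k + D.e k)) := by
  have h1 : D.N (k + 1) = D.N k - ((D.r - 2) * D.ω) • (D.w k + D.e k) - (D.r + D.μ) • D.X k :=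
    D.momentum_succ k
  unfold U
  rw [h1, D.w_succ, D.t_succ]
  module

lemma U_eq (k : ℕ) :
    D.U k = D.t k • D.X k + (D.η * D.t k) • D.d k
      + ((D.ω + D.σ) * D.t k - D.b) • (D.w k + D.e k) - (D.ω * D.t k) • D.w k := by
  rw [D.ω_add_σ]; rfl

/-- One-step estimate of the energy, up to a negligible part of the dissipation. -/
lemma exists_energy_succ_le : ∃ S : ℕ → ℝ, S =o[atTop] D.G ∧ ∀ k,
    D.energy (k + 1) - D.energy k ≤ -(D.μ + D.r) * D.t k * ‖D.X k‖ ^ 2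
      - ((D.r - 1) * D.ω + (D.μ + D.r) * D.σ) * D.t k * inner ℝ (D.w k) (D.X k)
      - (D.r - 2) * D.ω * D.σ * D.t k * ‖D.w k‖ ^ 2
      - D.ω * D.η / 12 * D.t k ^ 2 * (‖D.d k‖ ^ 2 + ‖D.e k‖ ^ 2) + S k := by
  set ω := D.ω with hω
  set σ := D.σ with hσ
  set g : ℕ → H := fun k => (-((D.r - 1) / D.t k)) • (D.w k + D.e k) with hg
  set h₀ : ℕ → H := fun k => D.d k + D.f k + D.e k with hh₀
  set R : ℕ → H := fun k =>
    -((D.r - 1) * ω) • D.w k - ((D.r - 2) * ω) • D.e k - (D.μ + D.r) • D.X k with hR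
  have sw := D.small_w
  have sX := D.small_X
  have se := D.small_e
  have sd := D.small_d
  have swe := sw.add se
  have sR : D.Small R := ((sw.smul _).sub (se.smul _)).sub (sX.smul _)
  have sg : D.Small g := by
    have := swe.inv_smul.smul (-(D.r - 1))
    refine this.congr_left fun k => ?_
    simp only [hg, smul_smul]; congr 1; ring
  -- The factor `1/t` in `g` compensates the multiplication by `t + 1`.
  have stg : D.Small fun k => (D.t k + 1) • g k := by
    have := sg.add (swe.smul (-(D.r - 1)))
    refine this.congr_left fun k => ?_
    have := (D.t_pos k).ne'
    simp only [hg, smul_smul, ← add_smul]; congr 1; field_simp; ring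
  have dh₀ : D.Dissipated fun k => D.t k • h₀ k := by
    have := (D.dissipated_d.add D.dissipated_f).add D.dissipated_e
    simpa [hh₀, smul_add] using this
  have sh₀ : D.Small h₀ := dh₀.small_of_smul
  have sh := sh₀.add sg
  have dth : D.Dissipated fun k => (D.t k + 1) • (h₀ k + g k) := by
    have := dh₀.t_add_one_smul.add stg.dissipated
    simpa [smul_add] using this
  have dde : D.Dissipated fun k => (D.t k + 1) • (D.η • D.d k + (ω + σ) • D.e k) := by
    refine Dissipated.t_add_one_smul ?_
    refine ((D.dissipated_d.smul D.η).add (D.dissipated_e.smul (ω + σ))).congr_left fun k => ?_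
    module
  -- The witness is the final bracket of `energy_step_identity`; each of its inner products has a
  -- small and a dissipated factor.
  refine ⟨fun k => inner ℝ (R k) (D.η • D.t k • D.d k + (ω + σ) • D.t k • D.e k
          - D.b • (D.w k + D.e k))
        - (D.r - 2) * ω * inner ℝ (D.X k + σ • D.w k) (D.t k • D.e k)
        + ω * inner ℝ (D.b • (D.w k + D.e k) - R k + σ • D.w k + D.η • D.d k + (ω + σ) • D.e k
            - D.ρ • (h₀ k + g k)) ((D.t k + 1) • (h₀ k + g k))
        + 1 / 2 * inner ℝ (R k) (R k) + σ * ω / 2 * inner ℝ (D.w k) (D.w k)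
        + 2 * ω * D.η * inner ℝ (D.e k) ((2 : ℝ) • D.t k • D.e k + D.e k)
        + ω * inner ℝ ((D.t k + 1) • g k) ((2 * D.ρ + (ω + σ)) • (D.t k + 1) • h₀ k
            + (D.ρ + (ω + σ) / 2) • (D.t k + 1) • g k
            - (D.t k + 1) • (D.η • D.d k + (ω + σ) • D.e k)), ?_, fun k => ?_⟩
  · have i1 := sR.inner_isLittleO (((D.dissipated_d.smul D.η).add
      (D.dissipated_e.smul (ω + σ))).sub (swe.smul D.b).dissipated)
    have i2 := ((sX.add (sw.smul σ)).inner_isLittleO D.dissipated_e).const_mul_left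
      ((D.r - 2) * ω)
    have i3 := (((((((swe.smul D.b).sub sR).add (sw.smul σ)).add (sd.smul D.η)).add
      (se.smul (ω + σ))).sub (sh.smul D.ρ)).inner_isLittleO dth).const_mul_left ω
    have i4 := (sR.inner_isLittleO sR.dissipated).const_mul_left (1 / 2)
    have i5 := (sw.inner_isLittleO sw.dissipated).const_mul_left (σ * ω / 2)
    have i6 := (se.inner_isLittleO ((D.dissipated_e.smul 2).add se.dissipated)).const_mul_left
      (2 * ω * D.η)
    have i7 := (stg.inner_isLittleO (((dh₀.t_add_one_smul.smul (2 * D.ρ + (ω + σ))).add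
      (stg.dissipated.smul (D.ρ + (ω + σ) / 2))).sub dde)).const_mul_left ω
    exact (((((i1.sub i2).add i3).add i4).add i5).add i6).add i7
  · have hid := energy_step_identity D.r D.μ D.ρ D.η D.b D.σ D.ω (D.t k) (D.X k) (D.w k) (D.e k)
      (D.d k) (D.f k) (g k) (D.e (k + 1))
    dsimp only at hid
    rw [← D.U_eq k] at hid
    have hU := D.U_succ k
    have hw : D.w (k + 1) = D.w k + (h₀ k + g k) := D.w_succ k
    have hE : D.energy (k + 1) - D.energy k = _ :=
      Eq.trans (by unfold energy; rw [hU, D.t_succ, hw]) hid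
    have hm := D.hypomonotone k
    rw [hw, add_sub_cancel_left] at hm
    have hlead := leading_form_le D.ρ D.η (ω + σ) D.ρ_nonneg
      (by rw [hω, hσ, D.ω_add_σ]; exact D.a_pos.le)
      (by rw [hω, hσ, D.ω_add_σ]; exact D.a_le) (D.d k) (D.f k) (D.e k) (D.e (k + 1))
      (D.error_le k)
    have ht := D.t_pos k
    have hωp : 0 < ω := D.ω_pos
    have c1 : 0 ≤ ω * (D.t k + 1) * D.t k * (inner ℝ (h₀ k + g k) (D.X k)
        + D.ρ * ‖h₀ k + g k‖ ^ 2) := mul_nonneg (by positivity) (by linarith)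
    have c2 := mul_le_mul_of_nonneg_left hlead (by positivity : 0 ≤ (D.t k + 1) ^ 2 * ω)
    have c3 : D.t k ^ 2 * (D.η / 12 * ω * (‖D.d k‖ ^ 2 + ‖D.e k‖ ^ 2))
        ≤ (D.t k + 1) ^ 2 * (D.η / 12 * ω * (‖D.d k‖ ^ 2 + ‖D.e k‖ ^ 2)) := by
      have := D.η_pos
      gcongr
      linarith
    rw [hE]
    simp only [hh₀, hg, hR] at c1 c2 ⊢
    linarith

/-- The weight `r(r+μ)/2` of `‖p‖²` is the one for which the `⟪p, X⟫` terms cancel. -/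
lemma lyapunov_succ_sub (k : ℕ) :
    D.lyapunov (k + 1) - D.lyapunov k = D.energy (k + 1) - D.energy k
      - D.r * (D.r - 2) * D.ω * inner ℝ (D.w k) (D.p k)
      - D.r * (D.r - 2) * D.ω * inner ℝ (D.e k) (D.p k)
      + D.r * D.t k * ‖D.X k‖ ^ 2 + D.r * D.a * D.t k * inner ℝ (D.w k) (D.X k)
      + (inner ℝ (D.X k) (D.r • D.η • D.t k • D.d k + (D.r * D.a) • D.t k • D.e k)
        - (D.r * D.b + D.r * (D.r - 2) * D.ω) * inner ℝ (D.X k) (D.w k + D.e k)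
        - D.r * (D.r + D.μ) / 2 * inner ℝ (D.X k) (D.X k)) := by
  have h1 : D.N (k + 1) = D.N k - ((D.r - 2) * D.ω) • (D.w k + D.e k) - (D.r + D.μ) • D.X k :=
    D.momentum_succ k
  have h2 : D.N k = D.t k • D.X k + (D.η * D.t k) • D.d k
    + (D.a * D.t k - D.b) • (D.w k + D.e k) := rfl
  unfold lyapunov
  rw [h1, D.p_succ, h2]
  simp only [← real_inner_self_eq_norm_sq, inner_add_left, inner_add_right,
    inner_sub_right, real_inner_smul_right, smul_add]
  rw [real_inner_comm (D.X k) (D.p k), real_inner_comm (D.X k) (D.w k),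
    real_inner_comm (D.e k) (D.p k), real_inner_comm (D.w k) (D.p k)]
  ring

/-- The `⟪w, X⟫` terms of order `t` cancel, and `-(μ+r) + r = -μ` remains in front of `t‖X‖²`.
Co-hypomonotonicity at the zero makes the `⟪w, p⟫` term harmless up to `ρ‖w‖² = o(G)`; only `⟪e, p⟫`
produces an error in `‖p‖²`. -/
lemma exists_lyapunov_succ_le : ∃ c C : ℝ, 0 < c ∧ 0 ≤ C ∧ ∀ᶠ k in atTop,
    D.lyapunov (k + 1) ≤ D.lyapunov k + C / D.t k ^ 2 * ‖D.p k‖ ^ 2 - c * D.G k := by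
  obtain ⟨S, hS, hE⟩ := D.exists_energy_succ_le
  have sw := D.small_w
  have sX := D.small_X
  have se := D.small_e
  have i1 := sX.inner_isLittleO (((D.dissipated_d.smul D.η).smul D.r).add
    (D.dissipated_e.smul (D.r * D.a)))
  have i2 := (sX.inner_isLittleO (sw.add se).dissipated).const_mul_left
    (D.r * D.b + D.r * (D.r - 2) * D.ω)
  have i3 := (sX.inner_isLittleO sX.dissipated).const_mul_left (D.r * (D.r + D.μ) / 2)
  have i4 := (sw.inner_isLittleO sw.dissipated).const_mul_left (D.r * (D.r - 2) * D.ω * D.ρ)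
  have hr := D.two_lt_r
  have hμ := D.one_lt_μ
  have hω := D.ω_pos
  have hσ := D.σ_pos
  have hη := D.η_pos
  have hr2 : 0 < D.r - 2 := by linarith
  -- Only half of `ωη/12` is retained: the other half absorbs the `e`-part of Young's inequality in
  -- `hY`. Half of `c₀` then pays for the `o(G)` terms.
  set c₀ := min D.μ (min ((D.r - 2) * D.ω * D.σ) (D.ω * D.η / 24)) with hc₀
  have hc₀pos : 0 < c₀ := by
    refine lt_min (by linarith) (lt_min (by positivity) (by positivity))
  have hc1 : c₀ ≤ D.μ := min_le_left _ _
  have hc2 : c₀ ≤ (D.r - 2) * D.ω * D.σ := (min_le_right _ _).trans (min_le_left _ _)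
  have hc3 : c₀ ≤ D.ω * D.η / 24 := (min_le_right _ _).trans (min_le_right _ _)
  set q := D.r * (D.r - 2) * D.ω with hq
  have hqpos : 0 < q := mul_pos (mul_pos (by linarith) hr2) hω
  refine ⟨c₀ / 2, q ^ 2 / (4 * (D.ω * D.η / 24)), by positivity, by positivity, ?_⟩
  have htot := (((hS.add i1).sub i2).sub i3).add i4
  filter_upwards [htot.bound (half_pos hc₀pos)] with k hk
  rw [Real.norm_of_nonneg (D.G_nonneg k)] at hk
  have hk' := (le_abs_self _).trans hk
  have ht := D.t_pos k
  have hL := D.lyapunov_succ_sub k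
  have hE := hE k
  have hs := D.hypomonotone_sol k
  have hs' := mul_le_mul_of_nonneg_left hs hqpos.le
  have hY : -(q * inner ℝ (D.e k) (D.p k)) ≤ D.ω * D.η / 24 * (D.t k ^ 2 * ‖D.e k‖ ^ 2)
      + q ^ 2 / (4 * (D.ω * D.η / 24)) / D.t k ^ 2 * ‖D.p k‖ ^ 2 := by
    set m := D.ω * D.η / 24 with hm
    have hmpos : 0 < m := by positivity
    have h1 : -(q * inner ℝ (D.e k) (D.p k)) ≤ q * (‖D.e k‖ * ‖D.p k‖) := by
      have := neg_le_of_abs_le (abs_real_inner_le_norm (D.e k) (D.p k))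
      nlinarith
    refine h1.trans ?_
    have h2 : 0 ≤ m * (D.t k * ‖D.e k‖ - q / (2 * m * D.t k) * ‖D.p k‖) ^ 2 := by positivity
    have h3 : m * (D.t k * ‖D.e k‖ - q / (2 * m * D.t k) * ‖D.p k‖) ^ 2
      = m * (D.t k ^ 2 * ‖D.e k‖ ^ 2) + q ^ 2 / (4 * m) / D.t k ^ 2 * ‖D.p k‖ ^ 2
        - q * (‖D.e k‖ * ‖D.p k‖) := by
      field_simp; ring
    linarith
  have hcross : D.r * D.a = (D.r - 1) * D.ω + (D.μ + D.r) * D.σ := by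
    rw [← D.ω_add_σ]; linarith [D.μ_mul_σ]
  rw [hcross] at hL
  rw [real_inner_self_eq_norm_sq (D.w k)] at hk'
  have hX : c₀ * (D.t k * ‖D.X k‖ ^ 2) ≤ D.μ * (D.t k * ‖D.X k‖ ^ 2) := by gcongr
  have hW : c₀ * (D.t k * ‖D.w k‖ ^ 2) ≤ (D.r - 2) * D.ω * D.σ * (D.t k * ‖D.w k‖ ^ 2) := by
    gcongr
  have hd : c₀ * (D.t k ^ 2 * ‖D.d k‖ ^ 2) ≤ D.ω * D.η / 24 * (D.t k ^ 2 * ‖D.d k‖ ^ 2) := by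
    gcongr
  have he : c₀ * (D.t k ^ 2 * ‖D.e k‖ ^ 2) ≤ D.ω * D.η / 24 * (D.t k ^ 2 * ‖D.e k‖ ^ 2) := by
    gcongr
  have hd0 : 0 ≤ D.ω * D.η / 24 * (D.t k ^ 2 * ‖D.d k‖ ^ 2) := by positivity
  have hG : D.G k = D.t k * ‖D.X k‖ ^ 2 + D.t k * ‖D.w k‖ ^ 2 + D.t k ^ 2 * ‖D.d k‖ ^ 2
    + D.t k ^ 2 * ‖D.e k‖ ^ 2 := rfl
  rw [hcross] at hk'
  have hGc : c₀ * D.G k = c₀ * (D.t k * ‖D.X k‖ ^ 2) + c₀ * (D.t k * ‖D.w k‖ ^ 2)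
    + c₀ * (D.t k ^ 2 * ‖D.d k‖ ^ 2) + c₀ * (D.t k ^ 2 * ‖D.e k‖ ^ 2) := by rw [hG]; ring
  linarith

/-- The Lyapunov function eventually controls the distance to the solution. -/
lemma eventually_le_lyapunov :
    ∀ᶠ k in atTop, D.r * D.μ / 2 * ‖D.p k‖ ^ 2 ≤ D.lyapunov k := by
  have hr := D.two_lt_r
  have hσ := D.σ_pos
  have hω := D.ω_pos
  have hη := D.η_pos
  -- From this threshold on, `σω/2 t²‖w‖²` absorbs the loss `rωρ t‖w‖²` from `⟪w, p⟫`. Completing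
  -- the square in `U + r p` leaves `rμ/2 ‖p‖²`.
  filter_upwards [D.tendsto_t.eventually_ge_atTop (2 * D.r * D.ρ / D.σ)] with k hk
  rw [div_le_iff₀ hσ] at hk
  have ht := D.t_pos k
  have hN : D.N k = D.U k + (D.ω * D.t k) • D.w k := by unfold U; abel
  have hs := D.hypomonotone_sol k
  have hs' := mul_le_mul_of_nonneg_left hs (by positivity : 0 ≤ D.r * D.ω * D.t k)
  have h1 : 0 ≤ ‖D.U k + D.r • D.p k‖ ^ 2 := by positivity
  have h2 : 0 ≤ 2 * D.ω * D.η * D.t k ^ 2 * ‖D.e k‖ ^ 2 := by positivity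
  have h3 : 0 ≤ (D.t k * D.σ - 2 * D.r * D.ρ) * (D.ω / 2 * D.t k * ‖D.w k‖ ^ 2) :=
    mul_nonneg (by linarith) (by positivity)
  unfold lyapunov energy
  rw [hN]
  simp only [← real_inner_self_eq_norm_sq, inner_add_left, inner_add_right,
    real_inner_smul_left, real_inner_smul_right] at *
  rw [real_inner_comm (D.U k) (D.p k)] at *
  rw [real_inner_comm (D.w k) (D.p k)] at *
  nlinarith

end ErrorDynamics

/-! ### Real sequences with summable perturbations -/

section Sequences

variable {V G t : ℕ → ℝ} {c C : ℝ}

/-- A nonnegative sequence which decreases by `c G` up to a factor `1 + O(t⁻²)` makes `G`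
summable. -/
theorem summable_of_perturbed_descent (hV : ∀ᶠ k in atTop, 0 ≤ V k) (hG : ∀ k, 0 ≤ G k)
    (ht : ∀ k, t (k + 1) = t k + 1) (htt : Tendsto t atTop atTop) (hc : 0 < c) (hC : 0 ≤ C)
    (h : ∀ᶠ k in atTop, V (k + 1) ≤ (1 + C / t k ^ 2) * V k - c * G k) : Summable G := by
  obtain ⟨K, hK⟩ := eventually_atTop.1 ((hV.and h).and (htt.eventually_ge_atTop 2))
  -- An integrating factor: `1/(t-1) - 1/t ≥ 1/t²`, so passing from `φ k` to `φ (k+1)` offsets the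
  -- factor `1 + C/t²`.
  set φ : ℕ → ℝ := fun k => Real.exp (C / (t k - 1)) with hφ
  have step : ∀ k ≥ K, φ (k + 1) * V (k + 1) ≤ φ k * V k - c * G k := by
    intro k hk
    obtain ⟨⟨hVk, hk1⟩, hk2⟩ := hK k hk
    have e1 : φ (k + 1) = Real.exp (C / t k) := by simp [hφ, ht]
    have one_le : 1 ≤ Real.exp (C / t k) := Real.one_le_exp (by positivity)
    have e2 : Real.exp (C / t k) * (1 + C / t k ^ 2) ≤ φ k := by
      calc Real.exp (C / t k) * (1 + C / t k ^ 2)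
          ≤ Real.exp (C / t k) * Real.exp (C / t k ^ 2) := by
            gcongr; rw [add_comm]; exact Real.add_one_le_exp _
        _ = Real.exp (C * (1 / t k + 1 / t k ^ 2)) := by rw [← Real.exp_add]; congr 1; ring
        _ ≤ φ k := by
            refine Real.exp_le_exp.2 ?_
            rw [div_eq_mul_one_div C]
            gcongr
            have h0 : 0 < t k := by linarith
            have h1 : 0 < t k - 1 := by linarith
            have h2 : 1 / (t k - 1) - (1 / t k + 1 / t k ^ 2) = 1 / (t k ^ 2 * (t k - 1)) := by
              field_simp; ring
            have h3 : 0 ≤ 1 / (t k ^ 2 * (t k - 1)) := by positivity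
            linarith
    have e3 := mul_le_mul_of_nonneg_left hk1 (zero_le_one.trans one_le)
    have e4 := mul_le_mul_of_nonneg_right e2 hVk
    have e5 : 1 * (c * G k) ≤ Real.exp (C / t k) * (c * G k) :=
      mul_le_mul_of_nonneg_right one_le (mul_nonneg hc.le (hG k))
    rw [e1]
    linarith
  have tele : ∀ n, ∑ j ∈ Finset.range n, G (j + K)
      ≤ (φ K * V K - φ (n + K) * V (n + K)) / c := by
    intro n
    induction n with
    | zero => simp
    | succ n ih =>
      have hs := step (n + K) (Nat.le_add_left _ _)
      rw [Finset.sum_range_succ, le_div_iff₀ hc]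
      rw [le_div_iff₀ hc] at ih
      rw [show n + 1 + K = n + K + 1 by ring]
      linarith
  rw [← summable_nat_add_iff K]
  refine summable_of_sum_range_le (c := φ K * V K / c) (fun n => hG _) fun n => (tele n).trans ?_
  gcongr
  have : 0 ≤ φ (n + K) * V (n + K) :=
    mul_nonneg (Real.exp_nonneg _) (hK (n + K) (Nat.le_add_left _ _)).1.1
  linarith

/-- A nonnegative sequence with summable increments converges. -/
theorem exists_tendsto_of_succ_le_add (hV : ∀ k, 0 ≤ V k) (hG : ∀ k, 0 ≤ G k) (hs : Summable G)
    (h : ∀ᶠ k in atTop, V (k + 1) ≤ V k + G k) : ∃ l, Tendsto V atTop (𝓝 l) := by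
  obtain ⟨K, hK⟩ := eventually_atTop.1 h
  -- Subtracting the partial sums makes the sequence antitone, and summability bounds it below.
  set W : ℕ → ℝ := fun n => V (n + K) - ∑ j ∈ Finset.range (n + K), G j with hW
  have anti : Antitone W := by
    refine antitone_nat_of_succ_le fun n => ?_
    have := hK (n + K) (Nat.le_add_left _ _)
    simp only [hW]
    rw [show n + 1 + K = n + K + 1 by ring, Finset.sum_range_succ]
    linarith
  have bdd : BddBelow (Set.range W) := by
    refine ⟨-∑' j, G j, ?_⟩
    rintro _ ⟨n, rfl⟩
    have := hs.sum_le_tsum (Finset.range (n + K)) fun i _ => hG i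
    have := hV (n + K)
    simp only [hW]
    linarith
  have h1 := tendsto_atTop_ciInf anti bdd
  have h2 := (tendsto_add_atTop_iff_nat K).2 hs.hasSum.tendsto_sum_nat
  refine ⟨_, (tendsto_add_atTop_iff_nat K).1 ((h1.add h2).congr fun n => ?_)⟩
  simp [hW]

/-- The limit exists; were it positive, `1 = O(t G) = O(k G)` would make the harmonic series
converge. -/
theorem tendsto_zero_of_isBigO_mul (hV : ∀ k, 0 ≤ V k) (hG : ∀ k, 0 ≤ G k) (hs : Summable G)
    (ht : t =O[atTop] fun k : ℕ => (k : ℝ))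
    (h : ∀ᶠ k in atTop, V (k + 1) ≤ V k + C * G k) (hC : 0 ≤ C)
    (hO : V =O[atTop] fun k => t k * G k) : Tendsto V atTop (𝓝 0) := by
  obtain ⟨l, hl⟩ := exists_tendsto_of_succ_le_add hV (fun k => mul_nonneg hC (hG k))
    (hs.mul_left C) h
  rcases (ge_of_tendsto' hl hV).eq_or_lt with h0 | h0
  · rwa [h0]
  · exfalso
    have h1 : (fun _ : ℕ => (1 : ℝ)) =O[atTop] V := by
      refine Asymptotics.IsBigO.of_bound (2 / l) ?_
      filter_upwards [hl.eventually_const_lt (half_lt_self h0)] with k hk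
      rw [Real.norm_of_nonneg (hV k), norm_one, div_mul_eq_mul_div, le_div_iff₀ h0]
      linarith
    have h2 := (h1.trans hO).trans (ht.mul (Asymptotics.isBigO_refl G atTop))
    have h3 : (fun k : ℕ => ((k : ℝ))⁻¹) =O[atTop] G := by
      have := (Asymptotics.isBigO_refl (fun k : ℕ => ((k : ℝ))⁻¹) atTop).mul h2
      refine (this.congr_left fun k => mul_one _).trans_eventuallyEq ?_
      filter_upwards [eventually_gt_atTop 0] with k hk
      have : (k : ℝ) ≠ 0 := by positivity
      field_simp
    exact Real.not_summable_natCast_inv (summable_of_isBigO_nat hs h3)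

lemma tendsto_zero_of_sq_le {H : Type*} [NormedAddCommGroup H] {v : ℕ → H} {s : ℕ → ℝ} (c : ℝ) (h : ∀ k, ‖v k‖ ^ 2 ≤ c * s k)
    (hs : Tendsto s atTop (𝓝 0)) : Tendsto v atTop (𝓝 0) := by
  have h1 : Tendsto (fun k => ‖v k‖ ^ 2) atTop (𝓝 0) :=
    squeeze_zero (fun k => by positivity) h (by simpa using hs.const_mul c)
  rw [tendsto_zero_iff_norm_tendsto_zero]
  simpa [Real.sqrt_sq] using h1.sqrt

end Sequences

/-! ### Summability and limits for the dynamics -/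

namespace ErrorDynamics

variable {H : Type*} [NormedAddCommGroup H] [InnerProductSpace ℝ H] (D : ErrorDynamics H)

/-- The lower bound of `lyapunov` by `‖p‖²` turns the error `C/t² ‖p‖²` into a relative one. -/
lemma summable_G : Summable D.G := by
  obtain ⟨c, C, hc, hC, h⟩ := D.exists_lyapunov_succ_le
  have hr := D.two_lt_r
  have hμ := D.one_lt_μ
  have hrμ : 0 < D.r * D.μ / 2 := by positivity
  have hlow := D.eventually_le_lyapunov
  refine summable_of_perturbed_descent (V := D.lyapunov) (t := D.t)
    (C := C / (D.r * D.μ / 2)) (hlow.mono fun k hk => le_trans (by positivity) hk) D.G_nonneg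
    D.t_succ D.tendsto_t hc (by positivity) ?_
  filter_upwards [h, hlow] with k hk hk'
  have h1 := mul_le_mul_of_nonneg_left hk'
    (by positivity : 0 ≤ C / (D.r * D.μ / 2) / D.t k ^ 2)
  have h2 : C / (D.r * D.μ / 2) / D.t k ^ 2 * (D.r * D.μ / 2 * ‖D.p k‖ ^ 2)
      = C / D.t k ^ 2 * ‖D.p k‖ ^ 2 := by
    have := D.t_pos k
    field_simp
  linarith

lemma t_isBigO : D.t =O[atTop] fun k : ℕ => (k : ℝ) := by
  have h0 := D.t_pos 0
  refine Asymptotics.IsBigO.of_bound (D.t 0 + 1) ?_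
  filter_upwards [eventually_ge_atTop 1] with k hk
  have hk' : (1 : ℝ) ≤ k := by exact_mod_cast hk
  rw [Real.norm_of_nonneg (D.t_pos k).le, Real.norm_of_nonneg (by positivity), D.t_eq]
  nlinarith

/-- Here `⟪w, X⟫` does not cancel, but `t |⟪w, X⟫| ≤ G`, which suffices once `G` is known to be
summable. -/
lemma exists_energy_succ_le_mul_G : ∃ C : ℝ, 0 ≤ C ∧ ∀ᶠ k in atTop,
    D.energy (k + 1) ≤ D.energy k + C * D.G k := by
  obtain ⟨S, hS, hE⟩ := D.exists_energy_succ_le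
  have hr := D.two_lt_r
  have hμ := D.one_lt_μ
  have hω := D.ω_pos
  have hσ := D.σ_pos
  have hη := D.η_pos
  have hr2 : 0 < D.r - 2 := by linarith
  have hr1 : 0 < D.r - 1 := by linarith
  set m := (D.r - 1) * D.ω + (D.μ + D.r) * D.σ with hm
  have hmpos : 0 < m := by positivity
  refine ⟨m + 1, by positivity, ?_⟩
  filter_upwards [hS.bound one_pos] with k hk
  rw [Real.norm_of_nonneg (D.G_nonneg k), one_mul] at hk
  have hk' := (le_abs_self _).trans hk
  have ht := D.t_pos k
  have h1 : -(m * D.t k * inner ℝ (D.w k) (D.X k)) ≤ m * D.G k := by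
    have h2 : -inner ℝ (D.w k) (D.X k) ≤ ‖D.w k‖ * ‖D.X k‖ :=
      neg_le.1 (neg_le_of_abs_le (abs_real_inner_le_norm _ _))
    have h3 : ‖D.w k‖ * ‖D.X k‖ ≤ ‖D.X k‖ ^ 2 + ‖D.w k‖ ^ 2 := by
      nlinarith [sq_nonneg (‖D.w k‖ - ‖D.X k‖), sq_nonneg ‖D.w k‖, sq_nonneg ‖D.X k‖]
    have h4 : D.t k * (‖D.X k‖ ^ 2 + ‖D.w k‖ ^ 2) ≤ D.G k := by
      have : 0 ≤ D.t k ^ 2 * ‖D.d k‖ ^ 2 + D.t k ^ 2 * ‖D.e k‖ ^ 2 := by positivity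
      unfold G; linarith
    calc -(m * D.t k * inner ℝ (D.w k) (D.X k)) = m * (D.t k * -inner ℝ (D.w k) (D.X k)) := by
          ring
      _ ≤ m * (D.t k * (‖D.X k‖ ^ 2 + ‖D.w k‖ ^ 2)) := by gcongr; exact h2.trans h3
      _ ≤ m * D.G k := by gcongr
  have h5 : 0 ≤ (D.μ + D.r) * D.t k * ‖D.X k‖ ^ 2 := by positivity
  have h6 : 0 ≤ (D.r - 2) * D.ω * D.σ * D.t k * ‖D.w k‖ ^ 2 := by positivity
  have h7 : 0 ≤ D.ω * D.η / 12 * D.t k ^ 2 * (‖D.d k‖ ^ 2 + ‖D.e k‖ ^ 2) := by positivity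
  linarith [hE k]

lemma Small.sq_isBigO {D : ErrorDynamics H} {v : ℕ → H} (h : D.Small v) :
    (fun k => D.t k ^ 2 * ‖v k‖ ^ 2) =O[atTop] fun k => D.t k * D.G k := by
  have h1 : (fun k => ‖v k‖ ^ 2) =O[atTop] fun k => D.G k / D.t k :=
    (h.norm_left.pow 2).congr_right fun k =>
      Real.sq_sqrt (div_nonneg (D.G_nonneg k) (D.t_pos k).le)
  refine ((Asymptotics.isBigO_refl (fun k => D.t k ^ 2) atTop).mul h1).congr_right fun k => ?_
  have := (D.t_pos k).ne'
  field_simp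

/-- Every vector in the energy is `t` times a small one, and `t² · G/t = t G`. -/
lemma energy_isBigO : D.energy =O[atTop] fun k => D.t k * D.G k := by
  have swe := D.small_w.add D.small_e
  have sU := (((D.small_X.add (D.small_d.smul D.η)).add (swe.smul D.a)).sub
    (swe.inv_smul.smul D.b)).sub (D.small_w.smul D.ω)
  have hU := (sU.sq_isBigO.congr_left (f₂ := fun k => ‖D.U k‖ ^ 2) fun k => by
    have ht := D.t_pos k
    rw [← sq_abs (D.t k), ← Real.norm_eq_abs, ← mul_pow, ← norm_smul]
    congr 2
    unfold U N
    match_scalars <;> field_simp).const_mul_left (1 / 2)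
  refine ((hU.add (D.small_w.sq_isBigO.const_mul_left (D.σ * D.ω / 2))).add
    (D.small_e.sq_isBigO.const_mul_left (2 * D.ω * D.η))).congr_left fun k => ?_
  unfold energy
  ring

lemma tendsto_energy : Tendsto D.energy atTop (𝓝 0) := by
  obtain ⟨C, hC, h⟩ := D.exists_energy_succ_le_mul_G
  exact tendsto_zero_of_isBigO_mul D.energy_nonneg D.G_nonneg D.summable_G D.t_isBigO h hC
    D.energy_isBigO

lemma tendsto_smul_d : Tendsto (fun k => D.t k • D.d k) atTop (𝓝 0) := by
  refine tendsto_zero_of_sq_le 1 (fun k => ?_) D.summable_G.tendsto_atTop_zero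
  have := D.t_pos k
  have : 0 ≤ D.t k * ‖D.X k‖ ^ 2 + D.t k * ‖D.w k‖ ^ 2 + D.t k ^ 2 * ‖D.e k‖ ^ 2 := by
    positivity
  rw [norm_smul, mul_pow, Real.norm_eq_abs, sq_abs]
  unfold G; linarith

lemma tendsto_smul_e : Tendsto (fun k => D.t k • D.e k) atTop (𝓝 0) := by
  refine tendsto_zero_of_sq_le 1 (fun k => ?_) D.summable_G.tendsto_atTop_zero
  have := D.t_pos k
  have : 0 ≤ D.t k * ‖D.X k‖ ^ 2 + D.t k * ‖D.w k‖ ^ 2 + D.t k ^ 2 * ‖D.d k‖ ^ 2 := by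
    positivity
  rw [norm_smul, mul_pow, Real.norm_eq_abs, sq_abs]
  unfold G; linarith

lemma tendsto_smul_w : Tendsto (fun k => D.t k • D.w k) atTop (𝓝 0) := by
  have hω := D.ω_pos
  have hσ := D.σ_pos
  have hη := D.η_pos
  refine tendsto_zero_of_sq_le (2 / (D.σ * D.ω)) (fun k => ?_) D.tendsto_energy
  have : 0 ≤ 1 / 2 * ‖D.U k‖ ^ 2 + 2 * D.ω * D.η * D.t k ^ 2 * ‖D.e k‖ ^ 2 := by positivity
  rw [norm_smul, mul_pow, Real.norm_eq_abs, sq_abs, div_mul_eq_mul_div, le_div_iff₀ (by positivity)]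
  unfold energy; linarith

lemma tendsto_U : Tendsto D.U atTop (𝓝 0) := by
  have hω := D.ω_pos
  have hσ := D.σ_pos
  have hη := D.η_pos
  refine tendsto_zero_of_sq_le 2 (fun k => ?_) D.tendsto_energy
  have : 0 ≤ D.σ * D.ω / 2 * D.t k ^ 2 * ‖D.w k‖ ^ 2
    + 2 * D.ω * D.η * D.t k ^ 2 * ‖D.e k‖ ^ 2 := by positivity
  unfold energy; linarith

/-- The displacements are `o(1 / t)`. -/
lemma tendsto_smul_X : Tendsto (fun k => D.t k • D.X k) atTop (𝓝 0) := by
  have ht : Tendsto (fun k => (D.t k)⁻¹) atTop (𝓝 0) := tendsto_inv_atTop_zero.comp D.tendsto_t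
  have hwe := D.tendsto_smul_w.add D.tendsto_smul_e
  have := (((D.tendsto_U.sub (D.tendsto_smul_d.const_smul D.η)).sub (hwe.const_smul D.a)).add
    ((ht.smul hwe).const_smul D.b)).add (D.tendsto_smul_w.const_smul D.ω)
  simp only [smul_zero, sub_zero, add_zero] at this
  refine this.congr fun k => ?_
  have ht := D.t_pos k
  unfold U N
  match_scalars <;> field_simp <;> ring

end ErrorDynamics

/-! ### Parameter bounds -/

namespace Params

variable {P : Params}

lemma two_lt_t₀ (hr : 2 < P.r) : 2 < P.t₀ :=
  hr.trans_le ((le_max_left _ _).trans (le_max_right _ _) |>.trans (le_max_right _ _))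

/-- The stepsize restriction bounds the errors of a step by the search direction. -/
lemma error_coeff_le (hL : 0 < P.L) (hr : 2 < P.r) (hεhat : 0 ≤ P.εhat) (hκ : 0 ≤ P.κ)
    (hκhat : 0 ≤ P.κhat) (hκhat' : P.κhat < P.κhatBound) (hη : 0 < P.η) (hη' : P.η < P.ηbar) :
    4 * (P.L * P.η) ^ 2 + 12 * (P.κ * (P.L * P.η) ^ 2 + P.κhat) ≤ 1 := by
  set Q := 4 + 12 * P.κ + 3 * P.κ * P.r + P.κ * P.εhat with hQ
  set c := 1 - 1 / (3 * P.r) - P.κhat * (12 + 3 * P.r + P.εhat) with hc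
  have hr0 : 0 < P.r := by linarith
  have hQ0 : 0 < Q := by positivity
  have hc0 : 0 < c := by
    unfold κhatBound at hκhat'
    rw [lt_div_iff₀ (by positivity)] at hκhat'
    have : c = (3 * P.r - 1 - P.κhat * (3 * P.r * (12 + 3 * P.r + P.εhat))) / (3 * P.r) := by
      rw [hc]; field_simp
    rw [this]
    exact div_pos (by linarith) (by positivity)
  have hr3 : 0 < 1 / (3 * P.r) := by positivity
  have hκr : 0 ≤ P.κhat * (3 * P.r + P.εhat) := by positivity
  -- Since `0 < c ≤ 1`, the stepsize bound gives `(Lη)² Q ≤ c² ≤ c ≤ 1 - 12κhat`, while `Q ≥ 4 +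
  -- 12κ`.
  have hc1 : c + 12 * P.κhat ≤ 1 := by rw [hc]; linarith
  have h1 : P.L * P.η * √Q < c := by
    unfold ηbar Ψ at hη'
    rw [lt_div_iff₀ hL, ← hQ, ← hc, one_div_mul_eq_div, lt_div_iff₀ (Real.sqrt_pos.2 hQ0)] at hη'
    linarith
  have h2 : (P.L * P.η) ^ 2 * Q ≤ c := by
    have h3 : (P.L * P.η) ^ 2 * Q = (P.L * P.η * √Q) ^ 2 := by
      rw [mul_pow _ (√Q), Real.sq_sqrt hQ0.le]
    have h4 : (P.L * P.η * √Q) ^ 2 ≤ c ^ 2 := by gcongr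
    have h5 : c ^ 2 ≤ c := by nlinarith
    linarith
  have h6 : 0 ≤ (P.L * P.η) ^ 2 * (P.κ * (3 * P.r + P.εhat)) := by positivity
  nlinarith

end Params

/-! ### The scheme as an instance of the dynamics -/

section Scheme

variable {H : Type*} [NormedAddCommGroup H] [InnerProductSpace ℝ H]
  {F : H → H} {T : H → Set H} {P : Params} {x y u ξ : ℕ → H}

/-- The error dynamics followed by the iterates of the scheme. -/
def IsGenerated.errorDynamics (hgen : IsGenerated P F T x y u ξ) {xs : H}
    (hxs : xs ∈ zer (sumOp F T)) (hρ : 0 ≤ P.ρ) (hmono : IsCoHypomonotone P.ρ (sumOp F T))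
    (hL : 0 < P.L) (hLip : ∀ a b, ‖F a - F b‖ ≤ P.L * ‖a - b‖) (hr : 2 < P.r) (hμ : 1 < P.μ)
    (hε : 0 ≤ P.ε) (hεhat : 0 ≤ P.εhat) (hκ : 0 ≤ P.κ) (hκhat : 0 ≤ P.κhat)
    (hκhat' : P.κhat < P.κhatBound) (hβη : P.β < P.η) (hη' : P.η < P.ηbar) :
    ErrorDynamics H where
  r := P.r
  μ := P.μ
  ρ := P.ρ
  η := P.η
  a := P.η - P.β
  -- With this shift `t_{k+1} η_k = a t_k - δ = a t_{k+1} - b`, so the coefficient of `z^{k+1}`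
  -- matches the momentum variable at index `k + 1`.
  b := P.η - P.β + P.δ
  t := P.t
  X k := x (k + 1) - x k
  w k := F (x k) + ξ k
  e k := u k - F (x k)
  d := dSeq P F y u ξ
  f k := F (x (k + 1)) - F (y k)
  p k := x k - xs
  two_lt_r := hr
  one_lt_μ := hμ
  ρ_nonneg := hρ
  a_pos := sub_pos.2 hβη
  a_le := by unfold Params.β; linarith
  one_le_t k := by
    have := Params.two_lt_t₀ hr
    have : (0 : ℝ) ≤ k := k.cast_nonneg
    unfold Params.t; linarith
  t_succ k := by unfold Params.t; push_cast; ring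
  p_succ k := by abel
  w_succ k := by
    have h1 := Params.two_lt_t₀ hr
    have h2 : (0 : ℝ) ≤ k := k.cast_nonneg
    have ht : P.t k ≠ 0 := by unfold Params.t; positivity
    have hγ : P.γ k = 1 - (P.r - 1) / P.t k := by unfold Params.γ; field_simp; ring
    unfold dSeq whatSucc zSeq
    rw [hγ]
    module
  momentum_succ k := by
    have h1 := Params.two_lt_t₀ hr
    have h2 : (0 : ℝ) ≤ k := k.cast_nonneg
    have ht : P.t k ≠ 0 := by unfold Params.t; positivity
    have hts : P.t (k + 1) = P.t k + 1 := by unfold Params.t; push_cast; ring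
    have ht' : P.t k + 1 ≠ 0 := by unfold Params.t; positivity
    -- The term `η d^{k+1}` belongs to the new momentum variable; multiplying by `t_{k+1}` clears
    -- the denominators of the coefficients.
    have hX : x (k + 1 + 1) - x (k + 1)
        = P.θ k • (x (k + 1) - x k) - pSeq P F y u ξ k - P.η • dSeq P F y u ξ (k + 1) := by
      rw [hgen.x_succ (k + 1), hgen.y_succ k]; abel
    have hw : whatSucc F y ξ k = dSeq P F y u ξ k + P.γ k • zSeq u ξ k := by
      unfold dSeq; abel
    have hz : ∀ j, F (x j) + ξ j + (u j - F (x j)) = zSeq u ξ j := fun j => by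
      unfold zSeq; abel
    rw [hX, hz, hz]
    unfold pSeq
    rw [hw]
    generalize dSeq P F y u ξ (k + 1) = d', dSeq P F y u ξ k = d, zSeq u ξ (k + 1) = z',
      zSeq u ξ k = z
    have hμ1 : P.μ + 1 ≠ 0 := by linarith
    unfold Params.θ Params.γ Params.ηseq Params.lam Params.ν Params.δ
    rw [hts]
    match_scalars <;> field_simp <;> ring
  hypomonotone k := hmono _ _ _ ⟨_, hgen.ξ_mem (k + 1), rfl⟩ _ ⟨_, hgen.ξ_mem k, rfl⟩
  hypomonotone_sol k := by
    have := hmono _ _ _ ⟨_, hgen.ξ_mem k, rfl⟩ _ hxs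
    simpa using this
  error_le k := by
    have hη : 0 < P.η := by
      have : 0 ≤ P.β := by unfold Params.β; positivity
      linarith
    have h1 : ‖F (x (k + 1)) - F (y k)‖ ≤ P.L * P.η * ‖dSeq P F y u ξ k‖ := by
      refine (hLip _ _).trans_eq ?_
      rw [hgen.x_succ k, sub_sub_cancel_left, norm_neg, norm_smul, Real.norm_of_nonneg hη.le]
      ring
    have h2 : ‖F (x (k + 1)) - F (y k)‖ ^ 2 ≤ (P.L * P.η) ^ 2 * ‖dSeq P F y u ξ k‖ ^ 2 := by
      rw [← mul_pow]; gcongr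
    have h3 := hgen.u_cond k
    rw [norm_sub_rev] at h3
    have h4 := mul_le_mul_of_nonneg_left h2 hκ
    have h5 := mul_le_mul_of_nonneg_right
      (Params.error_coeff_le hL hr hεhat hκ hκhat hκhat' hη hη')
      (sq_nonneg ‖dSeq P F y u ξ k‖)
    linarith

end Scheme

/-! ### From `t`-weighted limits to rates in `k` -/

section Rates

variable {H : Type*} [NormedAddCommGroup H] {t : ℕ → ℝ} {v : ℕ → H}

lemma tendsto_natCast_sq_mul [NormedSpace ℝ H] (ht : ∀ k : ℕ, (k : ℝ) ≤ t k)
    (h : Tendsto (fun k => t k • v k) atTop (𝓝 0)) :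
    Tendsto (fun k : ℕ => (k : ℝ) ^ 2 * ‖v k‖ ^ 2) atTop (𝓝 0) := by
  have h1 : Tendsto (fun k => ‖t k • v k‖ ^ 2) atTop (𝓝 0) := by simpa using h.norm.pow 2
  refine squeeze_zero (fun k => by positivity) (fun k => ?_) h1
  rw [norm_smul, mul_pow]
  gcongr
  exact (ht k).trans (le_abs_self _)

lemma isLittleO_one_div (h : Tendsto (fun k : ℕ => (k : ℝ) ^ 2 * ‖v k‖ ^ 2) atTop (𝓝 0)) :
    (fun k => ‖v k‖) =o[atTop] fun k : ℕ => 1 / (k : ℝ) := by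
  have h1 : Tendsto (fun k : ℕ => (k : ℝ) * ‖v k‖) atTop (𝓝 0) := by
    simpa [← mul_pow, Real.sqrt_sq, mul_nonneg] using h.sqrt
  refine (Asymptotics.isLittleO_iff_tendsto' ?_).2 (h1.congr fun k => by
    rw [div_div_eq_mul_div, div_one, mul_comm])
  filter_upwards [eventually_gt_atTop 0] with k hk h0
  have : (k : ℝ) ≠ 0 := by positivity
  simp_all

end Rates

end GAEG

end

theorem theorem7p5 {p : ℕ}
    (F : EuclideanSpace ℝ (Fin p) → EuclideanSpace ℝ (Fin p))
    (T : EuclideanSpace ℝ (Fin p) → Set (EuclideanSpace ℝ (Fin p)))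
    (P : GAEG.Params)
    (hzer : (GAEG.zer (GAEG.sumOp F T)).Nonempty)
    (hρ : 0 ≤ P.ρ)
    (hmono : GAEG.IsCoHypomonotone P.ρ (GAEG.sumOp F T))
    (hL : 0 < P.L)
    (hLip : ∀ a b, ‖F a - F b‖ ≤ P.L * ‖a - b‖)
    (hr : 2 < P.r) (hμ : 1 < P.μ)
    (hε : 0 ≤ P.ε) (hεhat : 0 ≤ P.εhat)
    (hκ : 0 ≤ P.κ) (hκhat : 0 ≤ P.κhat) (hκhat' : P.κhat < P.κhatBound)
    (hLρ : P.L * P.ρ < (P.r - 2) * P.Ψ / (8 * (P.r + P.μ - 1)))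
    (hβη : P.β < P.η)
    (hη : (P.r + P.μ - 1) * P.β / (P.r - 2) ≤ P.η)
    (hη' : P.η < P.ηbar)
    (x y u ξ : ℕ → EuclideanSpace ℝ (Fin p))
    (hgen : GAEG.IsGenerated P F T x y u ξ) :
    (Filter.Tendsto (fun k : ℕ => (k : ℝ) ^ 2 * ‖F (x k) + ξ k‖ ^ 2) Filter.atTop (nhds 0) ∧
      Filter.Tendsto (fun k : ℕ => (k : ℝ) ^ 2 * ‖x (k + 1) - x k‖ ^ 2) Filter.atTop (nhds 0) ∧
      Filter.Tendsto (fun k : ℕ => (k : ℝ) ^ 2 * ‖y k - x k‖ ^ 2) Filter.atTop (nhds 0)) ∧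
    ((fun k : ℕ => ‖F (x k) + ξ k‖) =o[Filter.atTop] (fun k : ℕ => 1 / (k : ℝ)) ∧
      (fun k : ℕ => ‖x (k + 1) - x k‖) =o[Filter.atTop] (fun k : ℕ => 1 / (k : ℝ)) ∧
      (fun k : ℕ => ‖y k - x k‖) =o[Filter.atTop] (fun k : ℕ => 1 / (k : ℝ))) := by
  obtain ⟨xs, hxs⟩ := hzer
  set D := hgen.errorDynamics hxs hρ hmono hL hLip hr hμ hε hεhat hκ hκhat hκhat' hβη hη'
  have ht : ∀ k : ℕ, (k : ℝ) ≤ P.t k := fun k => by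
    have := GAEG.Params.two_lt_t₀ hr
    unfold GAEG.Params.t; linarith
  have hX : Filter.Tendsto (fun k => P.t k • (x (k + 1) - x k)) Filter.atTop (nhds 0) :=
    D.tendsto_smul_X
  have hd : Filter.Tendsto (fun k => P.t k • GAEG.dSeq P F y u ξ k) Filter.atTop (nhds 0) :=
    D.tendsto_smul_d
  -- The `x`-update gives `y^k - x^k = (x^{k+1} - x^k) + η d^k`.
  have hY : Filter.Tendsto (fun k => P.t k • (y k - x k)) Filter.atTop (nhds 0) := by
    have := hX.add (hd.const_smul P.η)
    rw [smul_zero, add_zero] at this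
    refine this.congr fun k => ?_
    rw [hgen.x_succ k]
    module
  have h1 := GAEG.tendsto_natCast_sq_mul ht D.tendsto_smul_w
  have h2 := GAEG.tendsto_natCast_sq_mul ht hX
  have h3 := GAEG.tendsto_natCast_sq_mul ht hY
  exact ⟨⟨h1, h2, h3⟩, GAEG.isLittleO_one_div h1, GAEG.isLittleO_one_div h2,
    GAEG.isLittleO_one_div h3⟩
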